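/- Let $n, d \in \mathbb{N}$ (nonnegative integers) and let $\mathscr{M}_{n,d}$ be the finite-dimensional real vector space, with its usual topology, of all truncated moment sequences (tms) $y = (y_\alpha)$, $y_\alpha \in \mathbb{R}$, indexed by $\alpha \in \mathbb{N}^n$ with $|\alpha| = \alpha_1 + \cdots + \alpha_n \le d$. For a set $K \subseteq \mathbb{R}^n$, a $K$-measure is a nonnegative Borel measure $\mu$ on $\mathbb{R}^n$ supported in $K$, i.e. $\mu(\mathbb{R}^n \setminus K) = 0$ (for a non-Borel set $K$: $\mathbb{R}^n\setminus K$ is contained in a Borel $\mu$-null set), and $\mathscr{R}_d(K) \subseteq \mathscr{M}_{n,d}$ is the set of all $y$ for which there is a $K$-measure $\mu$ such that, for every $\alpha$ with $|\alpha| \le d$, the monomial $x^\alpha$ is $\mu$-integrable and $$y_\alpha = \int_K x^\alpha \, d\mu .$$ The Riesz functional of $y \in \mathscr{M}_{n,d}$ is the linear functional on the space $\mathbb{R}[x]_d$ of real polynomials in $x = (x_1,\dots,x_n)$ of degree at most $d$ given by $$\mathscr{L}_y\Big(\sum_{|\alpha| \le d} p_\alpha x^\alpha\Big) = \sum_{|\alpha|\le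 d} p_\alpha y_\alpha .$$ It is called strictly $K$-positive if $\mathscr{L}_y(p) > 0$ for every $p \in \mathbb{R}[x]_d$ that is nonnegative on $K$ and not identically zero on $K$. **Lemma.** Let $K \subseteq \mathbb{R}^n$ be a set with nonempty interior and let $y \in \mathscr{M}_{n,d}$. Then $y$ belongs to the interior of $\mathscr{R}_d(K)$ in $\mathscr{M}_{n,d}$ if and only if $\mathscr{L}_y$ is strictly $K$-positive. -/

import Mathlib

open MeasureTheory

namespace TruncatedMoment

/-- The multi-indices `α ∈ ℕⁿ` with `|α| = α₁ + ⋯ + αₙ ≤ d`. -/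
abbrev Index (n d : ℕ) : Type := {α : Fin n →₀ ℕ // α.degree ≤ d}

instance instFiniteIndex (n d : ℕ) : Finite (Index n d) :=
  (Finsupp.finite_of_degree_le d).to_subtype

noncomputable instance instFintypeIndex (n d : ℕ) : Fintype (Index n d) :=
  Fintype.ofFinite _

/-- The space of truncated moment sequences in `n` variables of degree `d`, a finite-dimensional
real vector space with its usual (product) topology. -/
abbrev TMS (n d : ℕ) : Type := Index n d → ℝ

/-- `μ` is a `K`-measure admitted by `y`: a nonnegative Borel measure on `ℝⁿ`, concentrated on `K`,
whose moments up to degree `d` exist and are the entries of `y`.  (The case `α = 0` of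
integrability says that `μ` has finite mass.) -/
structure IsRepresentingMeasure {n d : ℕ} (K : Set (Fin n → ℝ)) (y : TMS n d)
    (μ : Measure (Fin n → ℝ)) : Prop where
  supported : μ Kᶜ = 0
  integrable : ∀ α : Index n d, IntegrableOn (fun x => ∏ i, x i ^ α.1 i) K μ
  moment : ∀ α : Index n d, y α = ∫ x in K, ∏ i, x i ^ α.1 i ∂μ

/-- The set of all truncated moment sequences of degree `d` that admit a `K`-measure. -/
def momentCone {n : ℕ} (d : ℕ) (K : Set (Fin n → ℝ)) : Set (TMS n d) :=
  {y | ∃ μ : Measure (Fin n → ℝ), IsRepresentingMeasure K y μ}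

/-- The Riesz functional `∑ p_α x^α ↦ ∑ p_α y_α` on the polynomials of degree at most `d`. -/
noncomputable def riesz {n d : ℕ} (y : TMS n d) :
    MvPolynomial.restrictTotalDegree (Fin n) ℝ d →ₗ[ℝ] ℝ where
  toFun p := ∑ α : Index n d, MvPolynomial.coeff α.1 p.1 * y α
  map_add' p q := by
    simp [add_mul, Finset.sum_add_distrib]
  map_smul' c p := by
    simp [mul_assoc, Finset.mul_sum]

/-- The polynomials of degree at most `d` that are nonnegative on `K`. -/
def nonnegPolys {n : ℕ} (d : ℕ) (K : Set (Fin n → ℝ)) :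
    Set (MvPolynomial.restrictTotalDegree (Fin n) ℝ d) :=
  {p | ∀ x ∈ K, 0 ≤ MvPolynomial.eval x p.1}

/-- Strict `K`-positivity of a linear functional on the polynomials of degree at most `d`: it is
positive at every polynomial that is nonnegative on `K` and not identically zero on `K`. -/
def StrictlyPositive {n d : ℕ} (K : Set (Fin n → ℝ))
    (L : MvPolynomial.restrictTotalDegree (Fin n) ℝ d →ₗ[ℝ] ℝ) : Prop :=
  ∀ p ∈ nonnegPolys d K, (¬ ∀ x ∈ K, MvPolynomial.eval x p.1 = 0) → 0 < L p

end TruncatedMoment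

namespace TruncatedMoment

/-! The moment set is a convex cone containing the moments of point masses on `K`, and every linear
functional on `TMS n d` is `y ↦ riesz y p` for some `p`. From an interior `y` a small multiple of a
point mass can be subtracted, which forces strict positivity. Conversely, a `y` outside the interior
is separated from it by Hahn–Banach; the resulting `p` is nonnegative on `K` with `riesz y p ≤ 0`,
so strict positivity makes `p` vanish on `K`, hence `p = 0`, contradicting separation. -/

variable {n d : ℕ} {K : Set (Fin n → ℝ)}

/-- The moments up to degree `d` of the unit mass at `x`. -/
def pointMoments (d : ℕ) (x : Fin n → ℝ) : TMS n d := fun α => ∏ i, x i ^ α.1 i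

/-- The polynomial of degree at most `d` with prescribed coefficients. -/
noncomputable def polyOfCoeffs (a : TMS n d) : MvPolynomial.restrictTotalDegree (Fin n) ℝ d :=
  ⟨∑ α : Index n d, MvPolynomial.monomial α.1 (a α), by
    refine Submodule.sum_mem _ fun α _ => ?_
    rw [MvPolynomial.mem_restrictTotalDegree]
    refine (MvPolynomial.totalDegree_monomial_le _ _).trans ?_
    simpa [Finsupp.degree_eq_sum, Finsupp.sum_fintype] using α.2⟩

lemma coeff_polyOfCoeffs (a : TMS n d) (α : Index n d) :
    MvPolynomial.coeff α.1 (polyOfCoeffs a).1 = a α := by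
  classical
  simp only [polyOfCoeffs, MvPolynomial.coeff_sum, MvPolynomial.coeff_monomial]
  rw [Finset.sum_eq_single α]
  · simp
  · intro β _ hβ
    rw [if_neg fun h => hβ (Subtype.ext h)]
  · simp

lemma riesz_polyOfCoeffs (a y : TMS n d) : riesz y (polyOfCoeffs a) = ∑ α, a α * y α :=
  Finset.sum_congr rfl fun α _ => by rw [coeff_polyOfCoeffs]

lemma riesz_add (y z : TMS n d) (p : MvPolynomial.restrictTotalDegree (Fin n) ℝ d) :
    riesz (y + z) p = riesz y p + riesz z p := by
  simp [riesz, mul_add, Finset.sum_add_distrib]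

lemma riesz_smul (c : ℝ) (y : TMS n d) (p : MvPolynomial.restrictTotalDegree (Fin n) ℝ d) :
    riesz (c • y) p = c * riesz y p := by
  simp [riesz, Finset.mul_sum, mul_left_comm]

lemma riesz_pointMoments (x : Fin n → ℝ) (p : MvPolynomial.restrictTotalDegree (Fin n) ℝ d) :
    riesz (pointMoments d x) p = MvPolynomial.eval x p.1 := by
  classical
  rw [MvPolynomial.eval_eq']
  change ∑ α : Index n d, MvPolynomial.coeff α.1 p.1 * ∏ i, x i ^ α.1 i = _
  have hp : p.1.totalDegree ≤ d := (MvPolynomial.mem_restrictTotalDegree _ _ _).1 p.2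
  refine Finset.sum_bij_ne_zero (fun α _ _ => α.1) ?_ ?_ ?_ ?_
  · intro α _ h
    exact MvPolynomial.mem_support_iff.2 (left_ne_zero_of_mul h)
  · intro α _ _ β _ _ h
    exact Subtype.ext h
  · intro α hα h
    refine ⟨⟨α, ?_⟩, Finset.mem_univ _, h, rfl⟩
    have := (MvPolynomial.le_totalDegree hα).trans hp
    simpa [Finsupp.degree_eq_sum, Finsupp.sum_fintype] using this
  · intro α _ _
    rfl

/-- A linear functional on truncated moment sequences is evaluation of the Riesz functional at a
polynomial. -/
lemma exists_riesz_eq (f : TMS n d →ₗ[ℝ] ℝ) :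
    ∃ p : MvPolynomial.restrictTotalDegree (Fin n) ℝ d, ∀ y, riesz y p = f y := by
  classical
  refine ⟨polyOfCoeffs fun α => f (Pi.single α 1), fun y => ?_⟩
  rw [riesz_polyOfCoeffs, LinearMap.pi_apply_eq_sum_univ f y]
  refine Finset.sum_congr rfl fun α _ => ?_
  rw [smul_eq_mul, mul_comm]
  congr 2
  ext β
  simp [Pi.single_apply, eq_comm]

/-- A sup-norm ball inside `K` is a product of infinite sets, which determines a polynomial. -/
lemma eq_zero_of_eval_eq_zero (hK : (interior K).Nonempty) (p : MvPolynomial (Fin n) ℝ)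
    (hp : ∀ x ∈ K, MvPolynomial.eval x p = 0) : p = 0 := by
  obtain ⟨x, hx⟩ := hK
  obtain ⟨ε, hε, hball⟩ := Metric.isOpen_iff.1 isOpen_interior x hx
  refine MvPolynomial.funext_set (fun i => Metric.ball (x i) ε) (fun i => ?_) fun z hz => ?_
  · rw [Real.ball_eq_Ioo]
    exact Set.Ioo_infinite (by linarith)
  · rw [map_zero]
    refine hp z (interior_subset (hball ?_))
    rw [ball_pi _ hε]
    exact hz

lemma IsRepresentingMeasure.restrict_eq {y : TMS n d} {μ : Measure (Fin n → ℝ)}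
    (h : IsRepresentingMeasure K y μ) : μ.restrict K = μ :=
  Measure.restrict_eq_self_of_ae_mem (mem_ae_iff.2 h.supported)

lemma isRepresentingMeasure_iff {y : TMS n d} {μ : Measure (Fin n → ℝ)} :
    IsRepresentingMeasure K y μ ↔ μ Kᶜ = 0 ∧
      (∀ α : Index n d, Integrable (fun x => ∏ i, x i ^ α.1 i) μ) ∧
      ∀ α : Index n d, y α = ∫ x, ∏ i, x i ^ α.1 i ∂μ := by
  constructor
  · intro h
    have h₁ := h.integrable
    have h₂ := h.moment
    simp only [IntegrableOn, h.restrict_eq] at h₁ h₂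
    exact ⟨h.supported, h₁, h₂⟩
  · rintro ⟨h, h₁, h₂⟩
    have hr : μ.restrict K = μ := Measure.restrict_eq_self_of_ae_mem (mem_ae_iff.2 h)
    exact ⟨h, fun α => (h₁ α).integrableOn, fun α => by rw [hr]; exact h₂ α⟩

lemma add_mem_momentCone {y z : TMS n d} (hy : y ∈ momentCone d K) (hz : z ∈ momentCone d K) :
    y + z ∈ momentCone d K := by
  obtain ⟨μ, hμ⟩ := hy
  obtain ⟨ν, hν⟩ := hz
  rw [isRepresentingMeasure_iff] at hμ hν
  refine ⟨μ + ν, isRepresentingMeasure_iff.2 ⟨by simp [hμ.1, hν.1],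
    fun α => (hμ.2.1 α).add_measure (hν.2.1 α), fun α => ?_⟩⟩
  rw [integral_add_measure (hμ.2.1 α) (hν.2.1 α), Pi.add_apply, hμ.2.2 α, hν.2.2 α]

lemma smul_mem_momentCone {y : TMS n d} {c : ℝ} (hc : 0 ≤ c) (hy : y ∈ momentCone d K) :
    c • y ∈ momentCone d K := by
  obtain ⟨μ, hμ⟩ := hy
  rw [isRepresentingMeasure_iff] at hμ
  refine ⟨ENNReal.ofReal c • μ, isRepresentingMeasure_iff.2 ⟨by simp [hμ.1],
    fun α => (hμ.2.1 α).smul_measure ENNReal.ofReal_ne_top, fun α => ?_⟩⟩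
  rw [integral_smul_measure, ENNReal.toReal_ofReal hc, Pi.smul_apply, hμ.2.2 α]

lemma pointMoments_mem_momentCone {x : Fin n → ℝ} (hx : x ∈ K) :
    pointMoments d x ∈ momentCone d K := by
  refine ⟨Measure.dirac x, isRepresentingMeasure_iff.2 ⟨?_, fun α => ?_, fun α => ?_⟩⟩
  · rw [Measure.dirac_apply]
    simp [hx]
  · exact integrable_dirac (by simp)
  · rw [integral_dirac]
    rfl

lemma convex_momentCone : Convex ℝ (momentCone d K) := fun _ hy _ hz _ _ ha hb _ =>
  add_mem_momentCone (smul_mem_momentCone ha hy) (smul_mem_momentCone hb hz)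

lemma riesz_eq_integral {y : TMS n d} {μ : Measure (Fin n → ℝ)}
    (h : IsRepresentingMeasure K y μ) (p : MvPolynomial.restrictTotalDegree (Fin n) ℝ d) :
    riesz y p = ∫ x, MvPolynomial.eval x p.1 ∂μ := by
  rw [isRepresentingMeasure_iff] at h
  simp only [← riesz_pointMoments]
  change ∑ α, _ = ∫ x, ∑ α : Index n d, MvPolynomial.coeff α.1 p.1 * ∏ i, x i ^ α.1 i ∂μ
  rw [integral_finsetSum _ fun α _ => (h.2.1 α).const_mul _]
  refine Finset.sum_congr rfl fun α _ => ?_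
  rw [integral_const_mul, h.2.2 α]

lemma riesz_nonneg {y : TMS n d} (hy : y ∈ momentCone d K)
    {p : MvPolynomial.restrictTotalDegree (Fin n) ℝ d} (hp : p ∈ nonnegPolys d K) :
    0 ≤ riesz y p := by
  obtain ⟨μ, hμ⟩ := hy
  rw [riesz_eq_integral hμ]
  refine integral_nonneg_of_ae ?_
  filter_upwards [mem_ae_iff.2 hμ.supported] with x hx
  exact hp x hx

lemma strictlyPositive_of_mem_interior {y : TMS n d} (hy : y ∈ interior (momentCone d K)) :
    StrictlyPositive K (riesz y) := by
  intro p hp hne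
  push Not at hne
  obtain ⟨x, hx, hpx⟩ := hne
  have hpos : 0 < MvPolynomial.eval x p.1 := (hp x hx).lt_of_ne' hpx
  -- For small `ε > 0` the perturbed sequence stays in the cone, so `riesz y p ≥ ε * p(x) > 0`.
  have hcont : Filter.Tendsto (fun ε : ℝ => y + (-ε) • pointMoments d x)
      (nhdsWithin 0 (Set.Ioi 0)) (nhds y) := by
    have : Continuous fun ε : ℝ => y + (-ε) • pointMoments d x := by fun_prop
    simpa using (this.tendsto 0).mono_left nhdsWithin_le_nhds
  obtain ⟨ε, hmem, hε⟩ :=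
    ((hcont.eventually_mem (mem_interior_iff_mem_nhds.1 hy)).and self_mem_nhdsWithin).exists
  have h := riesz_nonneg hmem hp
  rw [riesz_add, riesz_smul, riesz_pointMoments] at h
  have := mul_pos (Set.mem_Ioi.1 hε) hpos
  linarith

lemma eq_zero_of_forall_pointMoments_eq_zero (hK : (interior K).Nonempty)
    (f : TMS n d →ₗ[ℝ] ℝ) (hf : ∀ x ∈ K, f (pointMoments d x) = 0) : f = 0 := by
  obtain ⟨p, hp⟩ := exists_riesz_eq f
  have h : p = 0 := Subtype.ext <| eq_zero_of_eval_eq_zero hK p.1 fun x hx => by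
    rw [← riesz_pointMoments, hp, hf x hx]
  ext y
  simp [← hp, h]

lemma zero_mem_momentCone : (0 : TMS n d) ∈ momentCone d K :=
  ⟨0, isRepresentingMeasure_iff.2 (by simp)⟩

/-- Otherwise the span would be proper, and a nonzero functional would kill all point moments. -/
lemma interior_momentCone_nonempty (hK : (interior K).Nonempty) :
    (interior (momentCone d K)).Nonempty := by
  rw [convex_momentCone.interior_nonempty_iff_affineSpan_eq_top,
    AffineSubspace.affineSpan_eq_top_iff_vectorSpan_eq_top_of_nonempty ℝ _ _
      ⟨0, zero_mem_momentCone⟩]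
  by_contra hne
  obtain ⟨f, hf, hker⟩ := Submodule.exists_le_ker_of_lt_top _ (lt_top_iff_ne_top.2 hne)
  refine hf (eq_zero_of_forall_pointMoments_eq_zero hK f fun x hx => hker ?_)
  simpa using vsub_mem_vectorSpan ℝ (pointMoments_mem_momentCone hx)
    (zero_mem_momentCone (d := d) (K := K))

lemma mem_interior_of_strictlyPositive (hK : (interior K).Nonempty) {y : TMS n d}
    (hy : StrictlyPositive K (riesz y)) : y ∈ interior (momentCone d K) := by
  by_contra hmem
  have hne := interior_momentCone_nonempty (d := d) hK
  obtain ⟨f, hf⟩ := geometric_hahn_banach_open_point convex_momentCone.interior isOpen_interior hmem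
  have hle : ∀ z ∈ momentCone d K, f z ≤ f y := by
    intro z hz
    -- Separation holds only on the interior; density extends it, weakly, to the whole cone.
    have hz' : z ∈ closure (interior (momentCone d K)) := by
      rw [convex_momentCone.closure_interior_eq_closure_of_nonempty_interior hne]
      exact subset_closure hz
    exact closure_minimal (fun a ha => (hf a ha).le) (isClosed_le f.continuous continuous_const) hz'
  have hy0 : 0 ≤ f y := by simpa using hle 0 zero_mem_momentCone
  have hnonpos : ∀ z ∈ momentCone d K, f z ≤ 0 := by
    intro z hz
    by_contra! hpos
    -- This scaling gives `f` the value `f y + 1`, above its bound `f y`.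
    have h := hle _ (smul_mem_momentCone (c := (f y + 1) / f z) (by positivity) hz)
    rw [map_smul, smul_eq_mul, div_mul_cancel₀ _ hpos.ne'] at h
    linarith
  obtain ⟨p, hp⟩ := exists_riesz_eq (-f.toLinearMap)
  have hpe : ∀ x, MvPolynomial.eval x p.1 = -f (pointMoments d x) := fun x => by
    rw [← riesz_pointMoments, hp]
    rfl
  have hzero : ∀ x ∈ K, MvPolynomial.eval x p.1 = 0 := by
    by_contra hnz
    have h := hy p (fun x hx => by
      rw [hpe]
      linarith [hnonpos _ (pointMoments_mem_momentCone hx)]) hnz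
    rw [hp] at h
    have h' : 0 < -f y := h
    linarith
  have hf0 : f.toLinearMap = 0 := eq_zero_of_forall_pointMoments_eq_zero hK _ fun x hx => by
    have h := hpe x
    rw [hzero x hx] at h
    exact neg_eq_zero.1 h.symm
  obtain ⟨a, ha⟩ := hne
  have h := hf a ha
  have hz : ∀ z, f z = 0 := fun z => LinearMap.congr_fun hf0 z
  simp [hz] at h

end TruncatedMoment


theorem lemma2p2 (n d : ℕ) (K : Set (Fin n → ℝ)) (hK : (interior K).Nonempty)
    (y : TruncatedMoment.TMS n d) :
    y ∈ interior (TruncatedMoment.momentCone d K) ↔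
      TruncatedMoment.StrictlyPositive K (TruncatedMoment.riesz y) :=

  ⟨TruncatedMoment.strictlyPositive_of_mem_interior,
    TruncatedMoment.mem_interior_of_strictlyPositive hK⟩
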